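/- Let $\gamma>0$ be a constant with $\gamma\neq 1$. A number $\lambda\in\mathbf{C}\setminus\{0\}$ is called an interior transmission eigenvalue (ITE) if there is a pair of functions $u,v\in C^2([0,1];\mathbf{C})$, not both identically zero, such that \[ -u''-\lambda^2u=0,\qquad -v''-\lambda^2\gamma^2v=0\quad\text{on }[0,1],\qquad u(0)=v(0)=0,\qquad u(1)=v(1),\quad u'(1)=v'(1). \] The algebraic multiplicity of an ITE $\lambda$ is its order as a zero of the entire function \[ \det\begin{pmatrix}\sin\lambda&-\sin\gamma\lambda\\ \cos\lambda&-\gamma\cos\gamma\lambda\end{pmatrix}=\sin\gamma\lambda\,\cos\lambda-\gamma\sin\lambda\,\cos\gamma\lambda . \] Let $N^{\rm alg}_{\mathbf C}(r)$ be the number of (real or non-real) ITEs $\lambda$ with $\operatorname{Re}\lambda>0$ and $|\lambda|\le r$, counted with algebraic multiplicity. Then every ITE has a finite algebraic multiplicity, at least $1$, the number $N^{\rm alg}_{\mathbf C}(r)$ is finite for every $r$, and \[ N^{\rm alg}_{\mathbf C}(r)=(1+\gamma)\frac r\pi+o(r)\qquad (r\to\infty). \] Moreover, the set of all ITEs is symmetric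 about the real axis ($\lambda$ is an ITE if and only if $\bar\lambda$ is), and it is contained in a strip $|\operatorname{Im}\lambda|\le C(\gamma)$ for some constant $C(\gamma)>0$ depending only on $\gamma$. -/

import Mathlib

open Set Filter Topology Asymptotics

noncomputable section

namespace HalfLineITE

/-- The interior transmission system on `[0,1]` with constant `γ` and spectral parameter `lam`:
`u` and `v` are twice continuously differentiable up to the end points (derivatives at the end
points are one-sided), satisfy the two equations, and satisfy the boundary conditions. -/
structure SolvesSystem (γ : ℝ) (lam : ℂ) (u v : ℝ → ℂ) : Prop where
  contDiff_u : ContDiffOn ℝ 2 u (Icc 0 1)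
  contDiff_v : ContDiffOn ℝ 2 v (Icc 0 1)
  eq_u : ∀ x ∈ Icc (0 : ℝ) 1,
    -iteratedDerivWithin 2 u (Icc 0 1) x - lam ^ 2 * u x = 0
  eq_v : ∀ x ∈ Icc (0 : ℝ) 1,
    -iteratedDerivWithin 2 v (Icc 0 1) x - lam ^ 2 * (γ : ℂ) ^ 2 * v x = 0
  u_zero : u 0 = 0
  v_zero : v 0 = 0
  u_one : u 1 = v 1
  deriv_one : derivWithin u (Icc 0 1) 1 = derivWithin v (Icc 0 1) 1

/-- `lam` is an interior transmission eigenvalue (ITE): `lam ≠ 0` and the system has a solution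
pair that does not vanish identically on `[0,1]`. -/
def IsITE (γ : ℝ) (lam : ℂ) : Prop :=
  lam ≠ 0 ∧ ∃ u v : ℝ → ℂ, SolvesSystem γ lam u v ∧ ∃ x ∈ Icc (0 : ℝ) 1, u x ≠ 0 ∨ v x ≠ 0

/-- The matrix of the conditions at `x = 1` on the coefficients `(a, b)` of
`u = a sin (lam x)`, `v = b sin (γ lam x)`. -/
def boundaryMatrix (γ : ℝ) (lam : ℂ) : Matrix (Fin 2) (Fin 2) ℂ :=
  !![Complex.sin lam, -Complex.sin (γ * lam);
     Complex.cos lam, -(γ * Complex.cos (γ * lam))]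

/-- The algebraic multiplicity: the order of `lam` as a zero of the determinant of the boundary
matrix (a priori in `ℕ∞`). -/
def algMult (γ : ℝ) (lam : ℂ) : ℕ∞ :=
  analyticOrderAt (fun z : ℂ => (boundaryMatrix γ z).det) lam

/-- The (possibly non-real) ITEs in the open right half-plane of modulus at most `r`. -/
def rightITEs (γ r : ℝ) : Set ℂ :=
  {lam : ℂ | IsITE γ lam ∧ 0 < lam.re ∧ ‖lam‖ ≤ r}

/-- The counting function of the ITEs in the open right half-plane of modulus at most `r`,
counted with algebraic multiplicity. -/
def countAlg (γ r : ℝ) : ℕ :=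
  ∑ᶠ lam ∈ rightITEs γ r, (algMult γ lam).toNat

end HalfLineITE

end

/-! Solving the two equations from `x = 0` turns the ITEs into the nonzero zeros of the determinant
(`isITE_iff`). Up to a factor `±1/2`, this is the odd entire function `f z = β sin (a z) - a sin (β
z)` with `a = 1 + γ` and `β = |1 - γ|`. Here `0 < β < a`, so `f` has exponential type `a`.

The zeros are counted by Jensen's formula. On suitable circles `log ‖f z‖ = a |Im z| + O(1)`, and
the mean of `|Im z|` over the circle of radius `R` is `2R/π`. So the logarithmic counting function
is `2aR/π + o(R)` (`logZeroCount_sineDiff_isLittleO`). The upper bound holds on every circle. The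
lower bound needs radii at which the two sines do not cancel; these are relatively dense, and
monotonicity fills the gaps.

A Tauberian step (`isLittleO_of_log_increments`) passes from the logarithmic count to the count
itself, with the same slope. Far from the real axis `sin (a z)` dominates, so all zeros lie in a
strip; only boundedly many are imaginary, and oddness pairs the others. Half of `2a/π` is the stated
`(1 + γ)/π`. -/

namespace HalfLineITE

/-! ### Jensen's formula and a Tauberian passage to the zero count -/

section ZeroCounting

open Real

variable {f : ℂ → ℂ}

/-- The number of zeros of `f` with `0 < ‖u‖ ≤ R`, counted with multiplicity. -/
noncomputable def zeroCount (f : ℂ → ℂ) (R : ℝ) : ℕ :=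
  ∑ᶠ u ∈ {u : ℂ | u ≠ 0 ∧ ‖u‖ ≤ R}, analyticOrderNatAt f u

/-- The logarithmic counting function `∑ m(u) log⁺ (R / ‖u‖)` of the nonzero zeros of `f`. -/
noncomputable def logZeroCount (f : ℂ → ℂ) (R : ℝ) : ℝ :=
  ∑ᶠ u : ℂ, (analyticOrderNatAt f u : ℝ) * log⁺ (R / ‖u‖)

theorem analyticOrderAt_ne_top_of_entire (hf : AnalyticOnNhd ℂ f univ) (h0 : ∃ z, f z ≠ 0)
    (u : ℂ) : analyticOrderAt f u ≠ ⊤ := by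
  obtain ⟨z, hz⟩ := h0
  refine hf.analyticOrderAt_ne_top_of_isPreconnected isPreconnected_univ (mem_univ z)
    (mem_univ u) ?_
  rw [(hf z (mem_univ z)).analyticOrderAt_eq_zero.2 hz]
  exact ENat.zero_ne_top

theorem divisor_closedBall_apply (hf : AnalyticOnNhd ℂ f univ) (h0 : ∃ z, f z ≠ 0) {R : ℝ}
    {u : ℂ} (hu : ‖u‖ ≤ |R|) :
    MeromorphicOn.divisor f (Metric.closedBall 0 |R|) u = analyticOrderNatAt f u := by
  rw [MeromorphicOn.AnalyticOnNhd.divisor_apply (hf.mono (subset_univ _)) (by simpa using hu),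
    ← Nat.cast_analyticOrderNatAt (analyticOrderAt_ne_top_of_entire hf h0 u)]
  simp

theorem finite_zeros (hf : AnalyticOnNhd ℂ f univ) (h0 : ∃ z, f z ≠ 0) (R : ℝ) :
    {u : ℂ | f u = 0 ∧ ‖u‖ ≤ R}.Finite := by
  refine ((MeromorphicOn.divisor f (Metric.closedBall 0 |R|)).finiteSupport
    (isCompact_closedBall _ _)).subset ?_
  rintro u ⟨hu, huR⟩
  rw [Function.mem_support, divisor_closedBall_apply hf h0 (huR.trans (le_abs_self R))]
  have h1 : analyticOrderAt f u ≠ 0 := (hf u (mem_univ u)).analyticOrderAt_ne_zero.2 hu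
  rw [← Nat.cast_analyticOrderNatAt (analyticOrderAt_ne_top_of_entire hf h0 u)] at h1
  exact_mod_cast h1

/-- The nonzero zeros in a closed disc, as a finset. -/
theorem exists_zeros_finset (hf : AnalyticOnNhd ℂ f univ) (h0 : ∃ z, f z ≠ 0) (R : ℝ) :
    ∃ Z : Finset ℂ, ∀ u, u ∈ Z ↔ f u = 0 ∧ u ≠ 0 ∧ ‖u‖ ≤ R := by
  have h : {u : ℂ | f u = 0 ∧ u ≠ 0 ∧ ‖u‖ ≤ R}.Finite :=
    (finite_zeros hf h0 R).subset fun u hu => ⟨hu.1, hu.2.2⟩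
  exact ⟨h.toFinset, fun u => by simp⟩

theorem finsum_mem_analyticOrderNatAt_eq_sum {Z : Finset ℂ} {s : Set ℂ}
    (hZ : ∀ u, f u = 0 → (u ∈ Z ↔ u ∈ s)) :
    ∑ᶠ u ∈ s, analyticOrderNatAt f u = ∑ u ∈ Z, analyticOrderNatAt f u := by
  refine finsum_mem_eq_sum_of_inter_support_eq _ ?_
  ext u
  simp only [mem_inter_iff, Function.mem_support, Finset.mem_coe]
  refine and_congr_left fun hu => (hZ u ?_).symm
  exact apply_eq_zero_of_analyticOrderNatAt_ne_zero hu

theorem zeroCount_eq_sum {R : ℝ} {Z : Finset ℂ}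
    (hZ : ∀ u, u ∈ Z ↔ f u = 0 ∧ u ≠ 0 ∧ ‖u‖ ≤ R) :
    zeroCount f R = ∑ u ∈ Z, analyticOrderNatAt f u :=
  finsum_mem_analyticOrderNatAt_eq_sum fun u hu => by simp [hZ, hu]

theorem logZeroCount_eq_sum {r R : ℝ} (hr : 0 ≤ r) (hrR : r ≤ R) {Z : Finset ℂ}
    (hZ : ∀ u, u ∈ Z ↔ f u = 0 ∧ u ≠ 0 ∧ ‖u‖ ≤ R) :
    logZeroCount f r = ∑ u ∈ Z, (analyticOrderNatAt f u : ℝ) * log⁺ (r / ‖u‖) := by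
  refine finsum_eq_sum_of_support_subset _ fun u hu => ?_
  rw [Function.mem_support] at hu
  have h1 : analyticOrderNatAt f u ≠ 0 := fun h => hu (by simp [h])
  have h2 : log⁺ (r / ‖u‖) ≠ 0 := fun h => hu (by simp [h])
  refine Finset.mem_coe.2 ((hZ u).2 ⟨apply_eq_zero_of_analyticOrderNatAt_ne_zero h1, ?_, ?_⟩)
  -- The origin drops out of the logarithmic sum: `r / 0 = 0` and `log⁺ 0 = 0`.
  · rintro rfl
    simp at h2
  · by_contra! h
    refine h2 ((posLog_eq_zero_iff _).2 ?_)
    rw [abs_of_nonneg (by positivity)]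
    exact div_le_one_of_le₀ (hrR.trans h.le) (norm_nonneg u)

/-- A nonzero zero in the smaller disc adds exactly its multiplicity times `log q` to the increment;
every other zero adds a nonnegative amount. -/
theorem zeroCount_mul_log_le (hf : AnalyticOnNhd ℂ f univ) (h0 : ∃ z, f z ≠ 0) {R q : ℝ}
    (hR : 0 < R) (hq : 1 < q) :
    zeroCount f R * log q ≤ logZeroCount f (q * R) - logZeroCount f R := by
  have hRq : R ≤ q * R := le_mul_of_one_le_left hR.le hq.le
  obtain ⟨Z, hZ⟩ := exists_zeros_finset hf h0 (q * R)
  obtain ⟨Z', hZ'⟩ := exists_zeros_finset hf h0 R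
  have hsub : Z' ⊆ Z := fun u hu => by
    rw [hZ'] at hu
    exact (hZ u).2 ⟨hu.1, hu.2.1, hu.2.2.trans hRq⟩
  rw [logZeroCount_eq_sum (by positivity) le_rfl hZ, logZeroCount_eq_sum hR.le hRq hZ,
    zeroCount_eq_sum hZ', ← Finset.sum_sub_distrib, Nat.cast_sum, Finset.sum_mul]
  refine (Finset.sum_le_sum fun u hu => ?_).trans
    (Finset.sum_le_sum_of_subset_of_nonneg hsub fun u _ _ => ?_)
  · obtain ⟨-, hu0, huR⟩ := (hZ' u).1 hu
    have hu' : 0 < ‖u‖ := norm_pos_iff.2 hu0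
    rw [← mul_sub]
    refine mul_le_mul_of_nonneg_left ?_ (Nat.cast_nonneg _)
    have h1 : 1 ≤ R / ‖u‖ := (one_le_div hu').2 huR
    have h2 : 1 ≤ q * R / ‖u‖ := (one_le_div hu').2 (huR.trans hRq)
    rw [posLog_eq_log (h1.trans (le_abs_self _)), posLog_eq_log (h2.trans (le_abs_self _)),
      mul_div_assoc, log_mul (by positivity) (by positivity)]
    linarith
  · rw [← mul_sub]
    refine mul_nonneg (Nat.cast_nonneg _) (sub_nonneg.2 (posLog_le_posLog (by positivity) ?_))
    gcongr

/-- No zero adds more than its multiplicity times `log q`, and zeros beyond `q * R` add nothing. -/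
theorem logZeroCount_sub_le (hf : AnalyticOnNhd ℂ f univ) (h0 : ∃ z, f z ≠ 0) {R q : ℝ}
    (hR : 0 < R) (hq : 1 < q) :
    logZeroCount f (q * R) - logZeroCount f R ≤ zeroCount f (q * R) * log q := by
  have hRq : R ≤ q * R := le_mul_of_one_le_left hR.le hq.le
  obtain ⟨Z, hZ⟩ := exists_zeros_finset hf h0 (q * R)
  rw [logZeroCount_eq_sum (by positivity) le_rfl hZ, logZeroCount_eq_sum hR.le hRq hZ,
    zeroCount_eq_sum hZ, ← Finset.sum_sub_distrib, Nat.cast_sum, Finset.sum_mul]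
  refine Finset.sum_le_sum fun u hu => ?_
  rw [← mul_sub]
  refine mul_le_mul_of_nonneg_left ?_ (Nat.cast_nonneg _)
  have h : log⁺ (q * (R / ‖u‖)) ≤ log⁺ q + log⁺ (R / ‖u‖) := posLog_mul
  rw [posLog_eq_log (hq.le.trans (le_abs_self q))] at h
  rw [mul_div_assoc]
  linarith

theorem logZeroCount_mono (hf : AnalyticOnNhd ℂ f univ) (h0 : ∃ z, f z ≠ 0) {r R : ℝ}
    (hr : 0 ≤ r) (hrR : r ≤ R) : logZeroCount f r ≤ logZeroCount f R := by
  obtain ⟨Z, hZ⟩ := exists_zeros_finset hf h0 R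
  rw [logZeroCount_eq_sum hr hrR hZ, logZeroCount_eq_sum (hr.trans hrR) le_rfl hZ]
  refine Finset.sum_le_sum fun u _ => mul_le_mul_of_nonneg_left ?_ (Nat.cast_nonneg _)
  exact posLog_le_posLog (by positivity) (by gcongr)

/-- **Jensen's formula** in terms of `logZeroCount`. -/
theorem circleAverage_log_norm_eq_logZeroCount (hf : AnalyticOnNhd ℂ f univ)
    (h0 : ∃ z, f z ≠ 0) {R : ℝ} (hR : 0 < R) :
    circleAverage (fun z => log ‖f z‖) 0 R = logZeroCount f R
      + analyticOrderNatAt f 0 * log R + log ‖meromorphicTrailingCoeffAt f 0‖ := by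
  rw [MeromorphicOn.circleAverage_log_norm hR.ne'
    (fun z _ => (hf z (mem_univ z)).meromorphicAt),
    divisor_closedBall_apply hf h0 (by simp), logZeroCount]
  congr 2
  refine finsum_congr fun u => ?_
  by_cases hu : ‖u‖ ≤ |R|
  · rw [divisor_closedBall_apply hf h0 hu, zero_sub, norm_neg, ← div_eq_mul_inv]
    rcases eq_or_ne u 0 with rfl | hu0
    · simp
    rw [posLog_eq_log]
    · simp
    · rw [abs_div, abs_norm]
      exact (one_le_div (norm_pos_iff.2 hu0)).2 hu
  · rw [Function.locallyFinsuppWithin.apply_eq_zero_of_notMem _ (by simpa using hu),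
      (posLog_eq_zero_iff _).2]
    · simp
    · rw [abs_div, abs_norm]
      exact div_le_one_of_le₀ (not_le.1 hu).le (norm_nonneg u)

/-- A function whose products with `log q` are squeezed between increments of an asymptotically
linear function is itself asymptotically linear with the same slope. -/
theorem isLittleO_of_log_increments {n S : ℝ → ℝ} {κ : ℝ} (hκ : 0 < κ)
    (hS : (fun R => S R - κ * R) =o[atTop] fun R : ℝ => R)
    (hle : ∀ R q : ℝ, 0 < R → 1 < q → n R * log q ≤ S (q * R) - S R)
    (hge : ∀ R q : ℝ, 0 < R → 1 < q → S (q * R) - S R ≤ n (q * R) * log q) :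
    (fun R => n R - κ * R) =o[atTop] fun R : ℝ => R := by
  refine isLittleO_iff.2 fun c hc => ?_
  -- Half of the error budget `c` pays for `q ≠ 1`, that is, for replacing `κ` by `κ * q` or `κ /
  -- q`.
  obtain ⟨q, hq, hq1, hq2⟩ : ∃ q : ℝ, 1 < q ∧ κ * q < κ + c / 2 ∧ κ - c / 2 < κ / q := by
    have h1 : Tendsto (fun q : ℝ => κ * q) (𝓝[>] 1) (𝓝 (κ * 1)) :=
      ((continuous_const.mul continuous_id).tendsto 1).mono_left nhdsWithin_le_nhds
    have h2 : Tendsto (fun q : ℝ => κ / q) (𝓝[>] 1) (𝓝 (κ / 1)) :=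
      (tendsto_const_nhds.div tendsto_id one_ne_zero).mono_left nhdsWithin_le_nhds
    have h3 := h1.eventually (gt_mem_nhds (show κ * 1 < κ + c / 2 by linarith))
    have h4 := h2.eventually (lt_mem_nhds (show κ - c / 2 < κ / 1 by linarith))
    obtain ⟨q, ha, hb, hd⟩ := (h3.and (h4.and self_mem_nhdsWithin)).exists
    exact ⟨q, hd, ha, hb⟩
  have hq0 : 0 < q := by linarith
  have hl : 0 < log q := log_pos hq
  have hl1 : log q ≤ q - 1 := log_le_sub_one_of_pos hq0
  have hl2 : 1 - q⁻¹ ≤ log q := one_sub_inv_le_log_of_pos hq0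
  -- The other half pays for the errors of `S` at `R` and `q * R`, in total `ε (q + 1) R = (c / 2) R
  -- log q`.
  set ε : ℝ := c / 2 * log q / (q + 1) with hε
  have hεpos : 0 < ε := by positivity
  have hεq : ε * (q + 1) = c / 2 * log q := by rw [hε]; field_simp
  have hS' : ∀ᶠ R in atTop, |S R - κ * R| ≤ ε * R := by
    filter_upwards [isLittleO_iff.1 hS hεpos, eventually_gt_atTop 0] with R h hR
    simpa [abs_of_pos hR] using h
  have hSq : ∀ᶠ R in atTop, |S (q * R) - κ * (q * R)| ≤ ε * (q * R) :=
    (tendsto_id.const_mul_atTop hq0).eventually hS'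
  have hSq' : ∀ᶠ R in atTop, |S (q⁻¹ * R) - κ * (q⁻¹ * R)| ≤ ε * (q⁻¹ * R) :=
    (tendsto_id.const_mul_atTop (inv_pos.2 hq0)).eventually hS'
  filter_upwards [hS', hSq, hSq', eventually_gt_atTop 0] with R h1 h2 h3 hR
  rw [norm_eq_abs, norm_eq_abs, abs_of_pos hR]
  rw [abs_le] at h1 h2 h3 ⊢
  have hi : 0 < q⁻¹ := inv_pos.2 hq0
  have hi1 : q⁻¹ < 1 := inv_lt_one_of_one_lt₀ hq
  have hqi : q * (q⁻¹ * R) = R := by field_simp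
  have ha := hle R q hR hq
  -- The lower bound on `n R` comes from the increment of `S` from `R / q` to `R`.
  have hb := hge (q⁻¹ * R) q (by positivity) hq
  rw [hqi] at hb
  constructor
  · refine le_of_mul_le_mul_right ?_ hl
    have e1 : κ / q * log q ≤ κ * (1 - q⁻¹) := by
      calc κ / q * log q ≤ κ / q * (q - 1) := by gcongr
        _ = κ * (1 - q⁻¹) := by field_simp
    have e2 : ε * (1 + q⁻¹) ≤ c / 2 * log q := by nlinarith
    nlinarith [mul_le_mul_of_nonneg_right e1 hR.le, mul_le_mul_of_nonneg_right e2 hR.le,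
      mul_lt_mul_of_pos_right hq2 (mul_pos hl hR)]
  · refine le_of_mul_le_mul_right ?_ hl
    have e1 : κ * (q - 1) ≤ κ * q * log q := by
      calc κ * (q - 1) = κ * q * (1 - q⁻¹) := by field_simp
        _ ≤ κ * q * log q := by gcongr
    nlinarith [mul_le_mul_of_nonneg_right e1 hR.le,
      mul_lt_mul_of_pos_right hq1 (mul_pos hl hR), congrArg (· * R) hεq]

end ZeroCounting

/-! ### Growth of the sine difference -/

section SineDifference

open Real

/-- The entire function `β sin (a z) - a sin (β z)`. -/
noncomputable def sineDiff (a β : ℝ) (z : ℂ) : ℂ :=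
  β * Complex.sin (a * z) - a * Complex.sin (β * z)

theorem analyticOnNhd_sineDiff (a β : ℝ) : AnalyticOnNhd ℂ (sineDiff a β) univ := by
  have h : Differentiable ℂ (sineDiff a β) := by
    unfold sineDiff
    fun_prop
  exact h.differentiableOn.analyticOnNhd isOpen_univ

theorem sineDiff_neg (a β : ℝ) (z : ℂ) : sineDiff a β (-z) = -sineDiff a β z := by
  simp only [sineDiff, mul_neg, Complex.sin_neg]
  ring

theorem two_mul_norm_sin (w : ℂ) :
    2 * ‖Complex.sin w‖ = ‖Complex.exp (-w * Complex.I) - Complex.exp (w * Complex.I)‖ := by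
  have h : 2 * ‖Complex.sin w‖ = ‖2 * Complex.sin w‖ := by simp
  rw [h, Complex.two_sin, norm_mul, Complex.norm_I, mul_one]

theorem norm_sin_le_exp (w : ℂ) : ‖Complex.sin w‖ ≤ exp |w.im| := by
  have h := norm_sub_le (Complex.exp (-w * Complex.I)) (Complex.exp (w * Complex.I))
  rw [← two_mul_norm_sin, Complex.norm_exp, Complex.norm_exp] at h
  have h1 : exp w.im ≤ exp |w.im| := exp_le_exp.2 (le_abs_self _)
  have h2 : exp (-w.im) ≤ exp |w.im| := exp_le_exp.2 (neg_le_abs _)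
  simp at h
  linarith

/-- Of the two exponentials making up the sine, one has modulus `exp |w.im|` and the other modulus
at most `1`. -/
theorem exp_sub_one_le_two_mul_norm_sin (w : ℂ) :
    exp |w.im| - 1 ≤ 2 * ‖Complex.sin w‖ := by
  have h := abs_norm_sub_norm_le (Complex.exp (-w * Complex.I)) (Complex.exp (w * Complex.I))
  rw [← two_mul_norm_sin, Complex.norm_exp, Complex.norm_exp] at h
  simp only [Complex.mul_re, Complex.neg_re, Complex.I_re, mul_zero, Complex.neg_im, Complex.I_im,
    mul_one, sub_neg_eq_add, zero_add, zero_sub] at h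
  rw [abs_le] at h
  rcases abs_cases w.im with ⟨h1, h2⟩ | ⟨h1, h2⟩
  · have : exp (-w.im) ≤ 1 := exp_le_one_iff.2 (by linarith)
    rw [h1]
    linarith
  · have : exp w.im ≤ 1 := exp_le_one_iff.2 h2.le
    rw [h1]
    linarith

variable {a β : ℝ}

theorem norm_sineDiff_le (hβ : 0 < β) (hab : β < a) (z : ℂ) :
    ‖sineDiff a β z‖ ≤ 2 * a * exp (a * |z.im|) := by
  have ha : 0 < a := hβ.trans hab
  have h1 : ‖Complex.sin (a * z)‖ ≤ exp (a * |z.im|) := by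
    simpa [abs_mul, abs_of_pos ha] using norm_sin_le_exp (a * z)
  have h2 : ‖Complex.sin (β * z)‖ ≤ exp (a * |z.im|) := by
    refine (norm_sin_le_exp (β * z)).trans (exp_le_exp.2 ?_)
    simp only [Complex.mul_im, Complex.ofReal_re, Complex.ofReal_im, zero_mul, add_zero, abs_mul,
      abs_of_pos hβ]
    gcongr
  calc ‖sineDiff a β z‖ ≤ β * ‖Complex.sin (a * z)‖ + a * ‖Complex.sin (β * z)‖ := by
        refine (norm_sub_le _ _).trans (le_of_eq ?_)
        simp [abs_of_pos ha, abs_of_pos hβ]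
    _ ≤ a * exp (a * |z.im|) + a * exp (a * |z.im|) := by gcongr
    _ = 2 * a * exp (a * |z.im|) := by ring

/-- Since `β < a`, the term with `sin (a z)` wins for large `|z.im|`. This confines the zeros to a
strip and also gives the Jensen lower bound outside it. -/
theorem exists_strip_norm_sineDiff_ge (hβ : 0 < β) (hab : β < a) :
    ∃ C : ℝ, 0 < C ∧ ∀ z : ℂ, C ≤ |z.im| → β / 8 * exp (a * |z.im|) ≤ ‖sineDiff a β z‖ := by
  have ha : 0 < a := hβ.trans hab
  have hd : 0 < a - β := sub_pos.2 hab
  -- This constant makes the losses `(β / 2 + a) exp (β t)` at most `β / 8 * exp (a t)`, against a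
  -- main term `β / 2 * exp (a t)`.
  have h1 : 1 < 4 + 8 * a / β := by
    have : 0 < 8 * a / β := by positivity
    linarith
  refine ⟨log (4 + 8 * a / β) / (a - β), div_pos (log_pos h1) hd, fun z hz => ?_⟩
  set t := |z.im| with ht
  have ht0 : 0 ≤ t := abs_nonneg _
  have h2 : 4 + 8 * a / β ≤ exp ((a - β) * t) := by
    rw [← log_le_iff_le_exp (by linarith)]
    rw [div_le_iff₀ hd] at hz
    linarith
  have h3 : (4 * β + 8 * a) * exp (β * t) ≤ β * exp (a * t) := by
    have e : exp (a * t) = exp ((a - β) * t) * exp (β * t) := by rw [← exp_add]; ring_nf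
    have e' : 4 * β + 8 * a = β * (4 + 8 * a / β) := by field_simp
    rw [e, e', mul_assoc]
    gcongr
  have h4 : 1 ≤ exp (β * t) := one_le_exp (by positivity)
  have h5 : exp (a * t) - 1 ≤ 2 * ‖Complex.sin (a * z)‖ := by
    simpa [abs_mul, abs_of_pos ha] using exp_sub_one_le_two_mul_norm_sin (a * z)
  have h6 : ‖Complex.sin (β * z)‖ ≤ exp (β * t) := by
    simpa [abs_mul, abs_of_pos hβ] using norm_sin_le_exp (β * z)
  have h7 : β * ‖Complex.sin (a * z)‖ - a * ‖Complex.sin (β * z)‖ ≤ ‖sineDiff a β z‖ := by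
    refine le_trans (le_of_eq ?_) (norm_sub_norm_le _ _)
    simp [abs_of_pos ha, abs_of_pos hβ]
  nlinarith [mul_le_mul_of_nonneg_left h5 hβ.le, mul_le_mul_of_nonneg_left h6 ha.le,
    mul_le_mul_of_nonneg_left h4 hβ.le]

/-- Radii at which `β sin (a R)` and `-a sin (β R)` do not cancel are relatively dense. -/
theorem exists_radius (hβ : 0 < β) (hab : β < a) :
    ∃ s D : ℝ, 0 < s ∧ ∀ X : ℝ, 0 ≤ X →
      ∃ R, X ≤ R ∧ R ≤ X + D ∧ s ≤ sin (β * R) ∧ sin (a * R) ≤ 0 := by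
  have ha : 0 < a := hβ.trans hab
  have hlt : β / a < 1 := (div_lt_one ha).2 hab
  have hpos : 0 < β / a := div_pos hβ ha
  -- `δ` solves `δ + π β / a = π - δ`: moving the radius by `π / a` flips the sign of `sin (a R)`
  -- but keeps `sin (β R) = sin δ`. So one of the two radii works.
  set δ := π * (1 - β / a) / 2 with hδ
  have hδ0 : 0 < δ := by
    have : 0 < 1 - β / a := by linarith
    positivity
  have hδπ : δ < π := by nlinarith [pi_pos]
  refine ⟨sin δ, (2 * π + δ) / β + π / a, sin_pos_of_pos_of_lt_pi hδ0 hδπ, fun X hX => ?_⟩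
  set k := ⌈X * β / (2 * π)⌉₊
  have hk1 : X * β ≤ 2 * π * k := by
    have := Nat.le_ceil (X * β / (2 * π))
    rw [div_le_iff₀ (by positivity)] at this
    linarith
  have hk2 : 2 * π * k ≤ X * β + 2 * π := by
    have := (Nat.ceil_lt_add_one (show 0 ≤ X * β / (2 * π) by positivity)).le
    have h := mul_le_mul_of_nonneg_left this (show 0 ≤ 2 * π by positivity)
    have e : 2 * π * (X * β / (2 * π) + 1) = X * β + 2 * π := by field_simp
    linarith
  set x := (δ + 2 * π * k) / β with hx
  have hβx : β * x = δ + k * (2 * π) := by rw [hx]; field_simp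
  have hsin : sin (β * x) = sin δ := by rw [hβx, sin_add_nat_mul_two_pi]
  have hxX : X ≤ x := by rw [hx, le_div_iff₀ hβ]; linarith
  have hxX' : x ≤ X + (2 * π + δ) / β := by
    rw [hx, div_le_iff₀ hβ, add_mul, div_mul_cancel₀ _ hβ.ne']
    linarith
  have hπa : 0 < π / a := by positivity
  rcases le_total (sin (a * x)) 0 with h | h
  · exact ⟨x, hxX, by linarith, hsin.ge, h⟩
  · refine ⟨x + π / a, by linarith, by linarith, ?_, ?_⟩
    · have e : β * (x + π / a) = π - δ + k * (2 * π) := by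
        rw [mul_add, hβx, hδ]
        field_simp
        ring
      rw [e, sin_add_nat_mul_two_pi, sin_pi_sub]
    · have e : a * (x + π / a) = a * x + π := by field_simp
      rw [e, sin_add_pi]
      linarith

theorem re_sineDiff (a β : ℝ) (z : ℂ) : (sineDiff a β z).re =
    β * (sin (a * z.re) * cosh (a * z.im)) - a * (sin (β * z.re) * cosh (β * z.im)) := by
  have h : ∀ c : ℝ, (Complex.sin (c * z)).re = sin (c * z.re) * cosh (c * z.im) := fun c => by
    rw [Complex.sin_eq]
    simp only [Complex.re_ofReal_mul, Complex.im_ofReal_mul, ← Complex.ofReal_sin,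
      ← Complex.ofReal_cosh, ← Complex.ofReal_cos, ← Complex.ofReal_sinh, ← Complex.ofReal_mul]
    simp [-Complex.ofReal_mul]
  simp [sineDiff, h]

/-- Allows sine conditions at the radius `‖z‖` to be transferred to `z.re` inside the strip, with
error `O(1 / ‖z‖)`. -/
theorem abs_norm_sub_re_le {z : ℂ} {C : ℝ} (hx : 0 ≤ z.re) (hC : |z.im| ≤ C) (hz : 0 < ‖z‖) :
    |z.re - ‖z‖| ≤ C ^ 2 / ‖z‖ := by
  have h1 : z.re ≤ ‖z‖ := Complex.re_le_norm z
  have h2 : ‖z‖ ^ 2 = z.re ^ 2 + z.im ^ 2 := by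
    rw [← Complex.normSq_eq_norm_sq, Complex.normSq_apply]
    ring
  have h3 : z.im ^ 2 ≤ C ^ 2 := sq_le_sq' (by linarith [neg_abs_le z.im]) ((le_abs_self _).trans hC)
  rw [abs_of_nonpos (by linarith), le_div_iff₀ hz]
  nlinarith

/-- Outside the strip the previous exponential bound applies. Inside it, for `0 ≤ z.re`, the real
part is at most `-a s + O(1 / ‖z‖)`, because `sin (a z.re)` is almost nonpositive and `sin (β z.re)`
is almost at least `s`. Oddness covers `z.re ≤ 0`. -/
theorem exists_norm_sineDiff_ge_on_circle (hβ : 0 < β) (hab : β < a) {s : ℝ} (hs : 0 < s) :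
    ∃ c R₀ : ℝ, 0 < c ∧ ∀ z : ℂ, R₀ ≤ ‖z‖ → s ≤ sin (β * ‖z‖) → sin (a * ‖z‖) ≤ 0 →
      c * exp (a * |z.im|) ≤ ‖sineDiff a β z‖ := by
  have ha : 0 < a := hβ.trans hab
  obtain ⟨C, hC0, hC⟩ := exists_strip_norm_sineDiff_ge hβ hab
  -- `M / ‖z‖` is the sum of the two transfer errors in the real part; large `‖z‖` brings it below
  -- `a s / 2`.
  set M := β * a * C ^ 2 * (cosh (a * C) + 1) with hM
  have hM0 : 0 < M := by have := cosh_pos (a * C); positivity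
  have key : ∀ z : ℂ, 2 * M / (a * s) ≤ ‖z‖ → 0 < ‖z‖ → 2 * β * C ^ 2 / s ≤ ‖z‖ →
      s ≤ sin (β * ‖z‖) → sin (a * ‖z‖) ≤ 0 → |z.im| ≤ C → 0 ≤ z.re →
      a * s / 2 ≤ ‖sineDiff a β z‖ := by
    intro z hz1 hz0 hz2 h1 h2 hzC hx
    have hd := abs_norm_sub_re_le hx hzC hz0
    set d := C ^ 2 / ‖z‖ with hdd
    have hd0 : 0 < d := by positivity
    have e1 : sin (a * z.re) ≤ a * d := by
      have := (abs_sin_sub_sin_le (a * z.re) (a * ‖z‖)).trans_eq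
        (by rw [← mul_sub, abs_mul, abs_of_pos ha])
      have := (le_abs_self _).trans (this.trans (mul_le_mul_of_nonneg_left hd ha.le))
      linarith
    have e2 : s - β * d ≤ sin (β * z.re) := by
      have := (abs_sin_sub_sin_le (β * z.re) (β * ‖z‖)).trans_eq
        (by rw [← mul_sub, abs_mul, abs_of_pos hβ])
      have := (neg_le_abs _).trans (this.trans (mul_le_mul_of_nonneg_left hd hβ.le))
      linarith
    have e3 : 1 ≤ cosh (β * z.im) := one_le_cosh _
    have e4 : cosh (a * z.im) ≤ cosh (a * C) := by
      rw [cosh_le_cosh, abs_mul, abs_mul, abs_of_pos hC0]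
      gcongr
    -- Nonnegativity is needed so that multiplying by `cosh ≥ 1` preserves the lower bound.
    have e5 : 0 ≤ s - β * d := by
      rw [div_le_iff₀ hs] at hz2
      have : β * d ≤ s := by
        rw [hdd, ← mul_div_assoc, div_le_iff₀ hz0]
        nlinarith [mul_pos hβ (pow_pos hC0 2)]
      linarith
    have e6 : β * a * d * (cosh (a * C) + 1) ≤ a * s / 2 := by
      rw [div_le_iff₀ (by positivity)] at hz1
      have : β * a * d * (cosh (a * C) + 1) = M / ‖z‖ := by rw [hM, hdd]; field_simp
      rw [this, div_le_iff₀ hz0]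
      linarith
    have f1 : sin (a * z.re) * cosh (a * z.im) ≤ a * d * cosh (a * C) := by
      have := cosh_pos (a * z.im)
      exact (mul_le_mul_of_nonneg_right e1 this.le).trans (by gcongr)
    have f2 : s - β * d ≤ sin (β * z.re) * cosh (β * z.im) :=
      e2.trans (le_mul_of_one_le_right (e5.trans e2) e3)
    have f3 : (sineDiff a β z).re ≤ -(a * s / 2) := by
      rw [re_sineDiff]
      nlinarith [mul_le_mul_of_nonneg_left f1 hβ.le, mul_le_mul_of_nonneg_left f2 ha.le]
    have := (neg_le_abs _).trans (Complex.abs_re_le_norm (sineDiff a β z))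
    linarith
  -- The factor `exp (-(a * C))` compensates `exp (a |z.im|)` inside the strip.
  refine ⟨min (β / 8) (a * s / 2 * exp (-(a * C))),
    max 1 (max (2 * M / (a * s)) (2 * β * C ^ 2 / s)), by positivity, fun z hz h1 h2 => ?_⟩
  have hz0 : 0 < ‖z‖ := zero_lt_one.trans_le ((le_max_left _ _).trans hz)
  have hz1 := ((le_max_left _ _).trans (le_max_right _ _)).trans hz
  have hz2 := ((le_max_right _ _).trans (le_max_right _ _)).trans hz
  rcases le_total C |z.im| with h | h
  · exact (mul_le_mul_of_nonneg_right (min_le_left _ _) (exp_pos _).le).trans (hC z h)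
  · have hle : min (β / 8) (a * s / 2 * exp (-(a * C))) * exp (a * |z.im|) ≤ a * s / 2 := by
      calc _ ≤ a * s / 2 * exp (-(a * C)) * exp (a * C) :=
            mul_le_mul (min_le_right _ _) (exp_le_exp.2 (by gcongr)) (exp_pos _).le
              (by positivity)
        _ = a * s / 2 := by rw [mul_assoc, ← exp_add]; simp
    refine hle.trans ?_
    rcases le_total 0 z.re with hx | hx
    · exact key z hz1 hz0 hz2 h1 h2 h hx
    · rw [← norm_neg, ← sineDiff_neg]
      exact key (-z) (by simpa using hz1) (by simpa using hz0) (by simpa using hz2)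
        (by simpa using h1) (by simpa using h2) (by simpa using h) (by simpa using hx)

theorem exists_sineDiff_ne_zero (hβ : 0 < β) (hab : β < a) : ∃ z, sineDiff a β z ≠ 0 := by
  obtain ⟨C, hC0, hC⟩ := exists_strip_norm_sineDiff_ge hβ hab
  refine ⟨C * Complex.I, norm_pos_iff.1 (lt_of_lt_of_le ?_ (hC _ ?_))⟩
  · positivity
  · simp [abs_of_pos hC0]

/-! ### Circle averages and the counting asymptotics -/

theorem integral_abs_sin : ∫ θ in (0 : ℝ)..2 * π, |sin θ| = 4 := by
  have hi : ∀ u v : ℝ, IntervalIntegrable (fun θ => |sin θ|) MeasureTheory.volume u v :=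
    fun u v => (continuous_sin.abs).intervalIntegrable u v
  rw [← intervalIntegral.integral_add_adjacent_intervals (hi 0 π) (hi π (2 * π))]
  have h1 : ∫ θ in (0 : ℝ)..π, |sin θ| = ∫ θ in (0 : ℝ)..π, sin θ := by
    refine intervalIntegral.integral_congr fun θ hθ => ?_
    rw [uIcc_of_le pi_pos.le] at hθ
    exact abs_of_nonneg (sin_nonneg_of_mem_Icc hθ)
  have h2 : ∫ θ in π..2 * π, |sin θ| = ∫ θ in (0 : ℝ)..π, |sin θ| := by
    have := intervalIntegral.integral_comp_add_right (a := 0) (b := π) (fun θ => |sin θ|) π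
    simp only [sin_add_pi, abs_neg, zero_add] at this
    rw [this, two_mul]
  rw [h2, h1, integral_sin]
  norm_num

theorem circleAverage_mul_abs_im_add (a c : ℝ) {R : ℝ} (hR : 0 ≤ R) :
    circleAverage (fun z : ℂ => a * |z.im| + c) 0 R = 2 * a / π * R + c := by
  rw [circleAverage]
  have h : ∀ θ : ℝ, a * |(circleMap 0 R θ).im| + c = a * R * |sin θ| + c := fun θ => by
    simp [circleMap_zero_im, abs_mul, abs_of_nonneg hR, mul_assoc]
  simp only [h]
  rw [intervalIntegral.integral_add
    ((by fun_prop : Continuous fun θ => a * R * |sin θ|).intervalIntegrable _ _)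
    (continuous_const.intervalIntegrable _ _), intervalIntegral.integral_const_mul,
    integral_abs_sin, intervalIntegral.integral_const]
  simp only [smul_eq_mul]
  field_simp
  ring

theorem circleIntegrable_mul_abs_im_add (a c R : ℝ) :
    CircleIntegrable (fun z : ℂ => a * |z.im| + c) 0 R := by
  refine ContinuousOn.circleIntegrable' ?_
  exact (by fun_prop : Continuous fun z : ℂ => a * |z.im| + c).continuousOn

theorem logZeroCount_sineDiff_isLittleO (hβ : 0 < β) (hab : β < a) :
    (fun R => logZeroCount (sineDiff a β) R - 2 * a / π * R) =o[atTop] fun R : ℝ => R := by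
  have ha : 0 < a := hβ.trans hab
  have hf := analyticOnNhd_sineDiff a β
  have h0 := exists_sineDiff_ne_zero hβ hab
  obtain ⟨s, D, hs, hrad⟩ := exists_radius hβ hab
  obtain ⟨c, R₀, hc, hlow⟩ := exists_norm_sineDiff_ge_on_circle hβ hab hs
  set m : ℝ := ((analyticOrderNatAt (sineDiff a β) 0 : ℕ) : ℝ)
  have hm0 : 0 ≤ m := Nat.cast_nonneg _
  set t := log ‖meromorphicTrailingCoeffAt (sineDiff a β) 0‖ with ht
  have hint : ∀ R, CircleIntegrable (fun z => log ‖sineDiff a β z‖) 0 R := fun R =>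
    MeromorphicOn.circleIntegrable_log_norm fun z _ => (hf z (mem_univ z)).meromorphicAt
  have hκ : 0 < 2 * a / π := by positivity
  have hupper : ∀ R, 1 ≤ R →
      logZeroCount (sineDiff a β) R ≤ 2 * a / π * R + (|log (2 * a)| + |t|) := by
    intro R hR
    have hJ := circleAverage_log_norm_eq_logZeroCount hf h0 (zero_lt_one.trans_le hR)
    have hle := circleAverage_mono (hint R)
      (circleIntegrable_mul_abs_im_add a |log (2 * a)| R) fun z _ => ?_
    · rw [circleAverage_mul_abs_im_add _ _ (by linarith), hJ] at hle
      have := mul_nonneg hm0 (log_nonneg hR)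
      linarith [neg_abs_le t]
    · rcases eq_or_ne (sineDiff a β z) 0 with h | h
      -- At a zero of the function `log 0 = 0`, so the majorant must be nonnegative; hence `|log (2
      -- * a)|`.
      · simp only [h, norm_zero, log_zero]
        positivity
      · have := log_le_log (norm_pos_iff.2 h) (norm_sineDiff_le hβ hab z)
        rw [log_mul (by positivity) (exp_pos _).ne', log_exp] at this
        linarith [le_abs_self (log (2 * a))]
  have hlower : ∀ R, 1 ≤ R → R₀ ≤ R → s ≤ sin (β * R) → sin (a * R) ≤ 0 →
      2 * a / π * R - (|log c| + |t|) - m * log R ≤ logZeroCount (sineDiff a β) R := by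
    intro R hR hR₀ h1 h2
    have hJ := circleAverage_log_norm_eq_logZeroCount hf h0 (zero_lt_one.trans_le hR)
    have hle := circleAverage_mono (circleIntegrable_mul_abs_im_add a (log c) R) (hint R)
      fun z hz => ?_
    · rw [circleAverage_mul_abs_im_add _ _ (by linarith), hJ] at hle
      linarith [le_abs_self t, neg_abs_le (log c)]
    · have hzR : ‖z‖ = R := by simpa [abs_of_pos (zero_lt_one.trans_le hR)] using hz
      have := log_le_log (by positivity)
        (hlow z (by rwa [hzR]) (by rwa [hzR]) (by rwa [hzR]))
      rw [log_mul hc.ne' (exp_pos _).ne', log_exp] at this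
      linarith
  have hall : ∀ᶠ R in atTop, ‖logZeroCount (sineDiff a β) R - 2 * a / π * R‖ ≤
      1 * ‖(|log (2 * a)| + |log c| + |t| + 2 * a / π * |D|) + m * log R‖ := by
    filter_upwards [eventually_ge_atTop (1 + |D|), eventually_ge_atTop (R₀ + |D|)] with R hR1 hR2
    have hD0 := abs_nonneg D
    have hDD := le_abs_self D
    -- A good radius in `[R - |D|, R]`: monotonicity carries its lower bound to `R` at a bounded
    -- cost.
    obtain ⟨r, hr1, hr2, hr3, hr4⟩ := hrad (R - |D|) (by linarith)
    have hl := hlower r (by linarith) (by linarith) hr3 hr4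
    have hmono := logZeroCount_mono hf h0 (by linarith) (show r ≤ R by linarith)
    have hu := hupper R (by linarith)
    have hlog : m * log r ≤ m * log R :=
      mul_le_mul_of_nonneg_left (log_le_log (by linarith) (by linarith)) hm0
    have hlog0 : 0 ≤ m * log R := mul_nonneg hm0 (log_nonneg (by linarith))
    have hr := mul_le_mul_of_nonneg_left hr1 hκ.le
    rw [mul_sub] at hr
    have hκD := mul_nonneg hκ.le hD0
    rw [one_mul, norm_eq_abs, norm_eq_abs]
    refine le_trans ?_ (le_abs_self _)
    have i1 := abs_nonneg (log c)
    have i2 := abs_nonneg (log (2 * a))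
    rw [abs_le]
    constructor <;> linarith
  refine (IsBigO.of_bound 1 hall).trans_isLittleO (IsLittleO.add ?_ ?_)
  · exact isLittleO_const_left.2 (Or.inr (tendsto_norm_atTop_atTop))
  · exact isLittleO_log_id_atTop.const_mul_left m

theorem zeroCount_sineDiff_isLittleO (hβ : 0 < β) (hab : β < a) :
    (fun R => (zeroCount (sineDiff a β) R : ℝ) - 2 * a / π * R) =o[atTop] fun R : ℝ => R :=
  isLittleO_of_log_increments (by have := hβ.trans hab; positivity)
    (logZeroCount_sineDiff_isLittleO hβ hab)
    (fun _ _ hR hq => zeroCount_mul_log_le (analyticOnNhd_sineDiff a β)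
      (exists_sineDiff_ne_zero hβ hab) hR hq)
    (fun _ _ hR hq => logZeroCount_sub_le (analyticOnNhd_sineDiff a β)
      (exists_sineDiff_ne_zero hβ hab) hR hq)

end SineDifference

/-! ### Eigenvalues as zeros of the determinant -/

section Boundary

theorem det_boundaryMatrix (γ : ℝ) (z : ℂ) : (boundaryMatrix γ z).det =
    Complex.sin (γ * z) * Complex.cos z - γ * Complex.sin z * Complex.cos (γ * z) := by
  rw [boundaryMatrix, Matrix.det_fin_two_of]
  ring

/-- Addition formulas for the sine. Oddness lets `|1 - γ|` replace `1 - γ`, the sign going into `c =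
±1/2`. -/
theorem exists_det_boundaryMatrix_eq_sineDiff {γ : ℝ} (hγ1 : γ ≠ 1) :
    ∃ c : ℂ, c ≠ 0 ∧
      (fun z => (boundaryMatrix γ z).det) = fun z => c * sineDiff (1 + γ) |1 - γ| z := by
  have hdet : ∀ z, (boundaryMatrix γ z).det =
      2⁻¹ * ((1 - γ) * Complex.sin ((1 + γ) * z) - (1 + γ) * Complex.sin ((1 - γ) * z)) := by
    intro z
    rw [det_boundaryMatrix, add_mul 1 (γ : ℂ) z, sub_mul 1 (γ : ℂ) z, one_mul, Complex.sin_add,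
      Complex.sin_sub]
    ring
  rcases lt_or_gt_of_ne hγ1 with h | h
  · refine ⟨2⁻¹, by norm_num, funext fun z => ?_⟩
    rw [hdet, sineDiff, abs_of_pos (by linarith)]
    push_cast
    ring
  · refine ⟨-2⁻¹, by norm_num, funext fun z => ?_⟩
    rw [hdet, sineDiff, abs_of_neg (by linarith)]
    push_cast
    rw [neg_mul (1 - (γ : ℂ)) z, Complex.sin_neg]
    ring

theorem det_boundaryMatrix_conj (γ : ℝ) (z : ℂ) :
    (boundaryMatrix γ ((starRingEnd ℂ) z)).det = (starRingEnd ℂ) (boundaryMatrix γ z).det := by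
  have h : (γ : ℂ) * (starRingEnd ℂ) z = (starRingEnd ℂ) (γ * z) := by simp
  rw [det_boundaryMatrix, det_boundaryMatrix, h, Complex.sin_conj, Complex.sin_conj,
    Complex.cos_conj, Complex.cos_conj]
  simp

/-- A solution of `u'' = -μ² u` on `[0,1]` with `u 0 = 0` is a multiple of `sin (μ x)`. -/
theorem solution_eq_sin {u : ℝ → ℂ} {μ : ℂ} (hu : ContDiffOn ℝ 2 u (Icc 0 1))
    (heq : ∀ x ∈ Icc (0 : ℝ) 1, iteratedDerivWithin 2 u (Icc 0 1) x = -μ ^ 2 * u x)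
    (h0 : u 0 = 0) :
    ∃ A : ℂ, ∀ x ∈ Icc (0 : ℝ) 1, μ * u x = A * Complex.sin (μ * x) ∧
      derivWithin u (Icc 0 1) x = A * Complex.cos (μ * x) := by
  set I : Set ℝ := Icc 0 1 with hI
  have hUI : UniqueDiffOn ℝ I := uniqueDiffOn_Icc zero_lt_one
  set d : ℝ → ℂ := derivWithin u I with hd
  have hu1 : ∀ x ∈ I, HasDerivWithinAt u (d x) I x := fun x hx =>
    ((hu.differentiableOn (by norm_num)) x hx).hasDerivWithinAt
  have hd1 : ∀ x ∈ I, HasDerivWithinAt d (-μ ^ 2 * u x) I x := by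
    intro x hx
    have hcd : ContDiffOn ℝ 1 d I := hu.derivWithin hUI (by norm_num)
    have h := ((hcd.differentiableOn (by norm_num)) x hx).hasDerivWithinAt
    have e : derivWithin d I x = -μ ^ 2 * u x := by
      rw [← heq x hx, iteratedDerivWithin_succ, iteratedDerivWithin_one]
    rwa [e] at h
  have hlin : ∀ x : ℝ, HasDerivWithinAt (fun x : ℝ => μ * (x : ℂ)) μ I x := fun x => by
    simpa using ((Complex.ofRealCLM.hasDerivAt (x := x)).const_mul μ).hasDerivWithinAt
  have hsin : ∀ x : ℝ, HasDerivWithinAt (fun x : ℝ => Complex.sin (μ * x))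
      (Complex.cos (μ * x) * μ) I x := fun x =>
    (Complex.hasDerivAt_sin _).comp_hasDerivWithinAt x (hlin x)
  have hcos : ∀ x : ℝ, HasDerivWithinAt (fun x : ℝ => Complex.cos (μ * x))
      (-Complex.sin (μ * x) * μ) I x := fun x =>
    (Complex.hasDerivAt_cos _).comp_hasDerivWithinAt x (hlin x)
  have hconst : ∀ g : ℝ → ℂ, (∀ x ∈ I, HasDerivWithinAt g 0 I x) → ∀ x ∈ I, g x = g 0 :=
    fun g hg => constant_of_derivWithin_zero (fun x hx => (hg x hx).differentiableWithinAt)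
      fun x hx => (hg x (Ico_subset_Icc_self hx)).derivWithin (hUI x (Ico_subset_Icc_self hx))
  -- The vector `(μ u, u')` rotates by the angle `μ x`; undoing the rotation gives two constants,
  -- `0` and `u' 0`. Then `sin² + cos² = 1` recovers both components.
  have hP := hconst (fun x => μ * u x * Complex.cos (μ * x) - d x * Complex.sin (μ * x))
    fun x hx => by
      refine ((((hu1 x hx).const_mul μ).mul (hcos x)).sub ((hd1 x hx).mul (hsin x))).congr_deriv ?_
      ring
  have hQ := hconst (fun x => μ * u x * Complex.sin (μ * x) + d x * Complex.cos (μ * x))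
    fun x hx => by
      refine ((((hu1 x hx).const_mul μ).mul (hsin x)).add ((hd1 x hx).mul (hcos x))).congr_deriv ?_
      ring
  refine ⟨d 0, fun x hx => ?_⟩
  have p := hP x hx
  have q := hQ x hx
  simp only [h0, Complex.ofReal_zero, mul_zero, Complex.sin_zero, Complex.cos_zero, mul_one,
    sub_zero, zero_add] at p q
  have hsc := Complex.sin_sq_add_cos_sq (μ * x)
  constructor
  · linear_combination Complex.cos (μ * x) * p + Complex.sin (μ * x) * q - μ * u x * hsc
  · linear_combination Complex.cos (μ * x) * q - Complex.sin (μ * x) * p - d x * hsc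

theorem hasDerivAt_const_mul_sin (A μ : ℂ) (x : ℝ) :
    HasDerivAt (fun x : ℝ => A * Complex.sin (μ * x)) (A * μ * Complex.cos (μ * x)) x := by
  have hlin : HasDerivAt (fun x : ℝ => μ * (x : ℂ)) μ x := by
    simpa using (Complex.ofRealCLM.hasDerivAt (x := x)).const_mul μ
  refine (((Complex.hasDerivAt_sin _).comp x hlin).const_mul A).congr_deriv ?_
  ring

theorem hasDerivAt_const_mul_cos (A μ : ℂ) (x : ℝ) :
    HasDerivAt (fun x : ℝ => A * Complex.cos (μ * x)) (-(A * μ * Complex.sin (μ * x))) x := by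
  have hlin : HasDerivAt (fun x : ℝ => μ * (x : ℂ)) μ x := by
    simpa using (Complex.ofRealCLM.hasDerivAt (x := x)).const_mul μ
  refine (((Complex.hasDerivAt_cos _).comp x hlin).const_mul A).congr_deriv ?_
  ring

theorem contDiff_const_mul_sin (A μ : ℂ) : ContDiff ℝ 2 fun x : ℝ => A * Complex.sin (μ * x) := by
  have h : ContDiff ℝ 2 fun x : ℝ => μ * (x : ℂ) := contDiff_const.mul Complex.ofRealCLM.contDiff
  exact contDiff_const.mul ((Complex.contDiff_sin.restrict_scalars ℝ).comp h)

theorem iteratedDerivWithin_const_mul_sin (A μ : ℂ) {x : ℝ} (hx : x ∈ Icc (0 : ℝ) 1) :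
    iteratedDerivWithin 2 (fun x : ℝ => A * Complex.sin (μ * x)) (Icc 0 1) x =
      -μ ^ 2 * (A * Complex.sin (μ * x)) := by
  rw [iteratedDerivWithin_eq_iteratedDeriv (uniqueDiffOn_Icc zero_lt_one)
    (contDiff_const_mul_sin A μ).contDiffAt hx, iteratedDeriv_succ, iteratedDeriv_one,
    funext fun x => (hasDerivAt_const_mul_sin A μ x).deriv, (hasDerivAt_const_mul_cos _ μ x).deriv]
  ring

theorem exists_sin_mul_ne_zero {μ : ℂ} (hμ : μ ≠ 0) :
    ∃ x ∈ Icc (0 : ℝ) 1, Complex.sin (μ * x) ≠ 0 := by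
  by_contra! h
  have h1 : derivWithin (fun x : ℝ => 1 * Complex.sin (μ * x)) (Icc 0 1) 0 = 0 := by
    rw [derivWithin_congr (f := fun _ => 0) (fun x hx => by simp [h x hx]) (by simp)]
    simp
  rw [(hasDerivAt_const_mul_sin 1 μ 0).hasDerivWithinAt.derivWithin
    (uniqueDiffOn_Icc zero_lt_one 0 (by simp))] at h1
  simp [hμ] at h1

theorem isITE_iff {γ : ℝ} (hγ : 0 < γ) (lam : ℂ) :
    IsITE γ lam ↔ lam ≠ 0 ∧ (boundaryMatrix γ lam).det = 0 := by
  have hγ0 : (γ : ℂ) ≠ 0 := by exact_mod_cast hγ.ne'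
  refine and_congr_right fun hl => ⟨?_, fun hdet => ?_⟩
  · rintro ⟨u, v, h, x, hx, hne⟩
    obtain ⟨A, hA⟩ := solution_eq_sin (μ := lam) h.contDiff_u
      (fun x hx => by linear_combination -h.eq_u x hx) h.u_zero
    obtain ⟨B, hB⟩ := solution_eq_sin (μ := γ * lam) h.contDiff_v
      (fun x hx => by linear_combination -h.eq_v x hx) h.v_zero
    obtain ⟨hA1, hA2⟩ := hA 1 (by simp)
    obtain ⟨hB1, hB2⟩ := hB 1 (by simp)
    rw [h.u_one] at hA1
    rw [h.deriv_one] at hA2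
    simp only [Complex.ofReal_one, mul_one] at hA1 hA2 hB1 hB2
    -- `A` and `B` are initial slopes, so the sine coefficients are `A / lam` and `B / (γ * lam)`;
    -- `e1` and `e2` are the conditions at `1` cleared of denominators.
    have e1 : γ * A * Complex.sin lam = B * Complex.sin (γ * lam) := by
      linear_combination hB1 - γ * hA1
    have e2 : A * Complex.cos lam = B * Complex.cos (γ * lam) := by rw [← hA2, ← hB2]
    have hAF : A * (boundaryMatrix γ lam).det = 0 := by
      rw [det_boundaryMatrix]
      linear_combination Complex.sin (γ * lam) * e2 - Complex.cos (γ * lam) * e1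
    have hBF : B * (boundaryMatrix γ lam).det = 0 := by
      rw [det_boundaryMatrix]
      linear_combination γ * Complex.sin lam * e2 - Complex.cos lam * e1
    by_contra hF
    have hA0 : A = 0 := (mul_eq_zero.1 hAF).resolve_right hF
    have hB0 : B = 0 := (mul_eq_zero.1 hBF).resolve_right hF
    have hux := (hA x hx).1
    have hvx := (hB x hx).1
    simp only [hA0, hB0, zero_mul, mul_eq_zero, hl, hγ0, false_or] at hux hvx
    exact hne.elim (fun h => h hux) fun h => h hvx
  · obtain ⟨w, hw, hMw⟩ := Matrix.exists_mulVec_eq_zero_iff.2 hdet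
    have e1 := congrFun hMw 0
    have e2 := congrFun hMw 1
    simp only [boundaryMatrix, Matrix.mulVec, dotProduct, Fin.sum_univ_two, Matrix.of_apply,
      Matrix.cons_val', Matrix.cons_val_zero, Matrix.cons_val_one, Pi.zero_apply,
      Matrix.cons_val_fin_one] at e1 e2
    have hd : ∀ A μ : ℂ, derivWithin (fun x : ℝ => A * Complex.sin (μ * x)) (Icc 0 1) 1 =
        A * μ * Complex.cos μ := fun A μ => by
      rw [(hasDerivAt_const_mul_sin A μ 1).hasDerivWithinAt.derivWithin
        (uniqueDiffOn_Icc zero_lt_one 1 (by simp))]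
      simp
    refine ⟨fun x => w 0 * Complex.sin (lam * x), fun x => w 1 * Complex.sin (γ * lam * x),
      ⟨(contDiff_const_mul_sin _ _).contDiffOn, (contDiff_const_mul_sin _ _).contDiffOn,
        fun x hx => ?_, fun x hx => ?_, by simp, by simp, ?_, ?_⟩, ?_⟩
    · rw [iteratedDerivWithin_const_mul_sin _ _ hx]
      ring
    · rw [iteratedDerivWithin_const_mul_sin _ _ hx]
      ring
    · simp only [Complex.ofReal_one, mul_one]
      linear_combination e1
    · rw [hd, hd]
      linear_combination lam * e2
    · rcases eq_or_ne (w 0) 0 with h0 | h0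
      · have h1 : w 1 ≠ 0 := fun h1 => hw (funext fun i => by fin_cases i <;> simp [h0, h1])
        obtain ⟨x, hx, hs⟩ := exists_sin_mul_ne_zero (mul_ne_zero hγ0 hl)
        exact ⟨x, hx, Or.inr (mul_ne_zero h1 hs)⟩
      · obtain ⟨x, hx, hs⟩ := exists_sin_mul_ne_zero hl
        exact ⟨x, hx, Or.inl (mul_ne_zero h0 hs)⟩

end Boundary

/-! ### Reduction to the right half-plane -/

section HalfPlane

theorem analyticOrderAt_const_mul {f : ℂ → ℂ} {c : ℂ} (hc : c ≠ 0) {z : ℂ}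
    (hf : AnalyticAt ℂ f z) : analyticOrderAt (fun w => c * f w) z = analyticOrderAt f z := by
  have h := analyticOrderAt_mul (analyticAt_const (v := c) (x := z)) hf
  rw [(analyticAt_const (v := c) (x := z)).analyticOrderAt_eq_zero.2 hc, zero_add] at h
  exact h

theorem analyticOrderNatAt_neg_of_odd {f : ℂ → ℂ} (hodd : ∀ z, f (-z) = -f z) (z : ℂ) :
    analyticOrderNatAt f (-z) = analyticOrderNatAt f z := by
  have h : analyticOrderAt (f ∘ fun w => -w) z = analyticOrderAt f (-z) :=
    analyticOrderAt_comp_of_deriv_ne_zero (by fun_prop) (by simp)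
  have e : (f ∘ fun w => -w) = -f := funext hodd
  rw [e, analyticOrderAt_neg] at h
  rw [analyticOrderNatAt, analyticOrderNatAt, h]

/-- For an odd entire function with zeros in a strip, the zeros with positive real part make up
half of all zeros, up to a bounded number. -/
theorem abs_zeroCount_sub_two_mul_le {f : ℂ → ℂ} (hf : AnalyticOnNhd ℂ f univ)
    (h0 : ∃ z, f z ≠ 0) (hodd : ∀ z, f (-z) = -f z) {C : ℝ} (hC : ∀ z, f z = 0 → |z.im| ≤ C)
    (r : ℝ) :
    |(zeroCount f r : ℝ) - 2 * ((∑ᶠ u ∈ {u : ℂ | f u = 0 ∧ 0 < u.re ∧ ‖u‖ ≤ r},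
      analyticOrderNatAt f u : ℕ) : ℝ)| ≤ zeroCount f C := by
  obtain ⟨Z, hZ⟩ := exists_zeros_finset hf h0 r
  obtain ⟨Z', hZ'⟩ := exists_zeros_finset hf h0 C
  have hpos : ∑ᶠ u ∈ {u : ℂ | f u = 0 ∧ 0 < u.re ∧ ‖u‖ ≤ r}, analyticOrderNatAt f u =
      ∑ u ∈ Z with 0 < u.re, analyticOrderNatAt f u := by
    refine finsum_mem_analyticOrderNatAt_eq_sum fun u hu => ?_
    simp only [Finset.mem_filter, hZ, mem_ofPred_eq, hu, true_and]
    refine ⟨fun h => ⟨h.2, h.1.2⟩, fun h => ⟨⟨?_, h.2⟩, h.1⟩⟩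
    rintro rfl
    simp at h
  have hneg : ∑ u ∈ Z with u.re < 0, analyticOrderNatAt f u =
      ∑ u ∈ Z with 0 < u.re, analyticOrderNatAt f u := by
    refine Finset.sum_nbij' (fun u => -u) (fun u => -u) ?_ ?_ (by simp) (by simp)
      fun u _ => (analyticOrderNatAt_neg_of_odd hodd u).symm
    all_goals
      intro u
      simp only [Finset.mem_filter, hZ, hodd, neg_eq_zero, ne_eq, norm_neg, Complex.neg_re]
      rintro ⟨h1, h2⟩
      exact ⟨h1, by linarith⟩
  -- An imaginary zero has modulus at most `C`, whatever `r` is.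
  have hzero : ∑ u ∈ Z with u.re = 0, analyticOrderNatAt f u ≤ zeroCount f C := by
    rw [zeroCount_eq_sum hZ']
    refine Finset.sum_le_sum_of_subset fun u hu => ?_
    rw [Finset.mem_filter, hZ] at hu
    obtain ⟨⟨h1, h2, -⟩, h3⟩ := hu
    refine (hZ' u).2 ⟨h1, h2, (Complex.norm_le_abs_re_add_abs_im u).trans ?_⟩
    rw [h3, abs_zero, zero_add]
    exact hC u h1
  have hsplit : zeroCount f r = 2 * (∑ u ∈ Z with 0 < u.re, analyticOrderNatAt f u) +
      ∑ u ∈ Z with u.re = 0, analyticOrderNatAt f u := by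
    rw [zeroCount_eq_sum hZ, ← Finset.sum_filter_add_sum_filter_not Z (fun u => 0 < u.re),
      ← Finset.sum_filter_add_sum_filter_not (Z.filter fun u => ¬0 < u.re) (fun u => u.re < 0),
      Finset.filter_filter, Finset.filter_filter, two_mul, add_assoc]
    congr 1
    rw [← hneg]
    congr 1 <;> refine Finset.sum_congr (Finset.filter_congr fun u _ => ?_) fun _ _ => rfl
    · exact ⟨fun h => h.2, fun h => ⟨by linarith, h⟩⟩
    · exact ⟨fun h => le_antisymm (not_lt.1 h.1) (not_lt.1 h.2),
        fun h => ⟨by rw [h]; exact lt_irrefl _, by rw [h]; exact lt_irrefl _⟩⟩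
  rw [hpos, hsplit]
  push_cast
  rw [add_sub_cancel_left, abs_of_nonneg (by positivity)]
  exact_mod_cast hzero

end HalfPlane

end HalfLineITE

/-! ### Assembly of the theorem -/

open HalfLineITE

theorem theorem4 (γ : ℝ) (hγ : 0 < γ) (hγ1 : γ ≠ 1) :
    -- the counting function is a genuine finite count
    ((∀ r : ℝ, (HalfLineITE.rightITEs γ r).Finite) ∧
      (∀ lam : ℂ, HalfLineITE.IsITE γ lam →
        1 ≤ HalfLineITE.algMult γ lam ∧ HalfLineITE.algMult γ lam ≠ ⊤)) ∧
    -- its asymptotics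
    ((fun r : ℝ => (HalfLineITE.countAlg γ r : ℝ) - (1 + γ) * (r / Real.pi))
      =o[atTop] (fun r : ℝ => r)) ∧
    -- symmetry about the real line
    (∀ lam : ℂ, HalfLineITE.IsITE γ lam →
      HalfLineITE.IsITE γ ((starRingEnd ℂ) lam)) ∧
    -- all ITEs lie in a strip
    (∃ C : ℝ, 0 < C ∧ ∀ lam : ℂ, HalfLineITE.IsITE γ lam → |lam.im| ≤ C) := by
  set a : ℝ := 1 + γ with ha
  set β : ℝ := |1 - γ| with hβdef
  have hβ : 0 < β := abs_pos.2 (sub_ne_zero.2 hγ1.symm)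
  have hab : β < a := abs_lt.2 ⟨by linarith, by linarith⟩
  have hf := analyticOnNhd_sineDiff a β
  have h0 := exists_sineDiff_ne_zero hβ hab
  obtain ⟨c, hc, hdet⟩ := exists_det_boundaryMatrix_eq_sineDiff hγ1
  have hITE : ∀ lam, IsITE γ lam ↔ lam ≠ 0 ∧ sineDiff a β lam = 0 := fun lam => by
    rw [isITE_iff hγ, congrFun hdet lam, mul_eq_zero, or_iff_right hc]
  have hmult : ∀ lam, algMult γ lam = analyticOrderAt (sineDiff a β) lam := fun lam => by
    rw [algMult, hdet, analyticOrderAt_const_mul hc (hf lam (mem_univ lam))]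
  obtain ⟨C, hC0, hC⟩ := exists_strip_norm_sineDiff_ge hβ hab
  have hstrip : ∀ z, sineDiff a β z = 0 → |z.im| ≤ C := fun z hz => by
    by_contra! h
    have := hC z h.le
    rw [hz, norm_zero] at this
    exact this.not_gt (by positivity)
  have hright : ∀ r, rightITEs γ r = {u : ℂ | sineDiff a β u = 0 ∧ 0 < u.re ∧ ‖u‖ ≤ r} := by
    intro r
    ext u
    simp only [rightITEs, hITE, mem_ofPred_eq]
    refine ⟨fun h => ⟨h.1.2, h.2⟩, fun h => ⟨⟨?_, h.1⟩, h.2⟩⟩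
    rintro rfl
    simp at h
  refine ⟨⟨fun r => ?_, fun lam hlam => ?_⟩, ?_, fun lam hlam => ?_, C, hC0,
    fun lam hlam => hstrip lam ((hITE lam).1 hlam).2⟩
  · rw [hright]
    exact (finite_zeros hf h0 r).subset fun u hu => ⟨hu.1, hu.2.2⟩
  · rw [hmult]
    exact ⟨Order.one_le_iff_ne_zero.2 ((hf lam (mem_univ lam)).analyticOrderAt_ne_zero.2
      ((hITE lam).1 hlam).2), analyticOrderAt_ne_top_of_entire hf h0 lam⟩
  · have hcount : ∀ r, |(zeroCount (sineDiff a β) r : ℝ) - 2 * countAlg γ r| ≤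
        zeroCount (sineDiff a β) C := fun r => by
      have := abs_zeroCount_sub_two_mul_le hf h0 (sineDiff_neg a β) hstrip r
      rw [countAlg, hright]
      simpa only [hmult, analyticOrderNatAt] using this
    have hdiff : (fun r => (zeroCount (sineDiff a β) r : ℝ) - 2 * countAlg γ r) =o[atTop]
        fun r : ℝ => r :=
      (IsBigO.of_bound (zeroCount (sineDiff a β) C : ℝ) (g := fun _ : ℝ => (1 : ℝ))
        (Eventually.of_forall fun r => by simpa using hcount r)).trans_isLittleO
        (isLittleO_const_left.2 (Or.inr tendsto_norm_atTop_atTop))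
    -- Twice the right half-plane count is the full count up to `o(r)`, so halving turns `2a/π` into
    -- `a/π`.
    refine (((zeroCount_sineDiff_isLittleO hβ hab).sub hdiff).const_mul_left 2⁻¹).congr_left
      fun r => ?_
    ring
  · rw [isITE_iff hγ] at hlam ⊢
    exact ⟨(map_ne_zero _).2 hlam.1, by rw [det_boundaryMatrix_conj, hlam.2, map_zero]⟩
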